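/- Let $n$ be a natural number. Let $\Gamma^*_n$ be the set of entropic functions, i.e. of all functions $h : 2^{[n]} \to \mathbb{R}$ for which there are jointly distributed random variables $X_1,\dots,X_n$ with finite domains such that $h(\alpha) = H\big((X_i)_{i\in\alpha}\big)$ for every $\alpha \subseteq [n]$, where $H$ denotes Shannon entropy with logarithms in base 2. Let $\overline{\Gamma^*_n}$ be its topological closure in $\mathbb{R}^{2^n}$ (the almost entropic functions). A CI is a formula $\sigma = (Y;Z\mid X)$ with arbitrary (possibly overlapping or empty) $X,Y,Z\subseteq[n]$; for a function $h : 2^{[n]} \to \mathbb{R}$ put $$h(\sigma) = h(X\cup Y)+h(X\cup Z)-h(X\cup Y\cup Z)-h(X),$$ and for a set $\Sigma$ of CIs put $h(\Sigma)=\sum_{\sigma\in\Sigma}h(\sigma)$. **Theorem.** Let $\Sigma$ be a set of CIs and $\tau$ a CI, and suppose that for every $h\in\overline{\Gamma^*_n}$, $h(\Sigma)=0$ implies $h(\tau)=0$. Then for every $\varepsilon>0$ there is $\lambda>0$ such that for all $h\in\overline{\Gamma^*_n}$, $$h(\tau)\le\lambda\cdot h(\Sigma)+\varepsilon\cdot h([n]).$$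 -/

import Mathlib

/-- A conditional independence formula `(Y ; Z | X)` over the variables indexed by `Fin n`.
The three sets are arbitrary: they may overlap, coincide or be empty. -/
structure CI (n : ℕ) where
  Y : Finset (Fin n)
  Z : Finset (Fin n)
  X : Finset (Fin n)

/-- `h(σ) = I_h(Y ; Z | X) = h(XY) + h(XZ) - h(XYZ) - h(X)` for `σ = (Y ; Z | X)`. -/
def CI.value {n : ℕ} (h : Finset (Fin n) → ℝ) (σ : CI n) : ℝ :=
  h (σ.X ∪ σ.Y) + h (σ.X ∪ σ.Z) - h (σ.X ∪ σ.Y ∪ σ.Z) - h σ.X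

/-- `h(S) = ∑ σ ∈ S, h(σ)` for a set `S` of conditional independence formulas. -/
def ciSum {n : ℕ} (h : Finset (Fin n) → ℝ) (S : Finset (CI n)) : ℝ :=
  ∑ σ ∈ S, CI.value h σ

/-- Shannon entropy in bits, `∑ x, p x * log₂ (1 / p x)`, of a mass function on a finite set
(a point of mass zero contributes zero). -/
noncomputable def shannonEntropy {D : Type} [Fintype D] (p : D → ℝ) : ℝ :=
  ∑ x, p x * Real.logb 2 (1 / p x)

open Classical in
/-- The mass function of the joint variable `X_α = (X_i : i ∈ α)`, where `p` is the joint mass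
function of `X_1, …, X_n`. -/
noncomputable def marginal {n : ℕ} {D : Fin n → Type} [∀ i, Fintype (D i)]
    (p : (∀ i, D i) → ℝ) (α : Finset (Fin n)) : (∀ i : α, D i) → ℝ :=
  fun y => ∑ x : (∀ i, D i), if (fun i : α => x i) = y then p x else 0

/-- The set `Γ*_n` of entropic functions: those `h` for which there are finite domains
`D_1, …, D_n` and a joint probability mass function `p` on their product such that
`h(α)` is the entropy of `X_α` for every `α`. -/
def entropicFunctions (n : ℕ) : Set (Finset (Fin n) → ℝ) :=
  {h | ∃ (D : Fin n → Type) (_ : ∀ i, Fintype (D i)) (p : (∀ i, D i) → ℝ),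
    (∀ x, 0 ≤ p x) ∧ ∑ x, p x = 1 ∧ ∀ α, h α = shannonEntropy (marginal p α)}

/-- The set of almost entropic functions, the topological closure of `Γ*_n` in `ℝ^(2^n)`. -/
def almostEntropicFunctions (n : ℕ) : Set (Finset (Fin n) → ℝ) :=
  closure (entropicFunctions n)

/-- The exact implication `S ⇒ τ` holds in `K`: for all `h ∈ K`, if `h(S) = 0` then
`h(τ) = 0`. -/
def ExactImplication {n : ℕ} (K : Set (Finset (Fin n) → ℝ)) (S : Finset (CI n))
    (τ : CI n) : Prop :=
  ∀ h ∈ K, ciSum h S = 0 → CI.value h τ = 0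

/-! The almost entropic functions form a closed cone on which every CI has nonnegative value. By
homogeneity it suffices to treat `h([n]) = 1`; monotonicity and `h ∅ = 0` then confine `h` to the
unit cube, so the slice is compact. On its part where `h(τ) ≥ ε`, the continuous function `h(Σ)`
never vanishes, by the exact implication, so it has a minimum `m > 0`. Since `h(τ) ≤ 2` on the
slice, `λ = 2 / m` works.

Besides submodularity of entropy, the main input is closure under scaling: independent copies give
integer multiples, and rare activation scales back down at vanishing cost. -/

open Classical in
/-- The mass function of the random variable `f` on the finite space `Ω` with mass function `q`. -/
noncomputable def law {Ω A : Type} [Fintype Ω] (q : Ω → ℝ) (f : Ω → A) (a : A) : ℝ :=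
  ∑ ω, if f ω = a then q ω else 0

/-- The entropy in bits of the random variable `f`, as an expectation over the sample space. -/
noncomputable def entropyOf {Ω A : Type} [Fintype Ω] (q : Ω → ℝ) (f : Ω → A) : ℝ :=
  -∑ ω, q ω * Real.logb 2 (law q f (f ω))

/-! ### Entropy of variables on a finite probability space -/

section Entropy

variable {Ω A B C E : Type} [Fintype Ω]

theorem sum_law_mul [Fintype A] (q : Ω → ℝ) (f : Ω → A) (g : A → ℝ) :
    ∑ a, law q f a * g a = ∑ ω, q ω * g (f ω) := by
  classical
  simp only [law, Finset.sum_mul]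
  rw [Finset.sum_comm]
  refine Finset.sum_congr rfl fun ω _ => ?_
  simp [ite_mul]

theorem shannonEntropy_law [Fintype A] (q : Ω → ℝ) (f : Ω → A) :
    shannonEntropy (law q f) = entropyOf q f := by
  rw [shannonEntropy, sum_law_mul q f (fun a => Real.logb 2 (1 / law q f a)), entropyOf,
    ← Finset.sum_neg_distrib]
  simp [Real.logb_inv]

theorem sum_law [Fintype A] (q : Ω → ℝ) (f : Ω → A) : ∑ a, law q f a = ∑ ω, q ω := by
  simpa using sum_law_mul q f 1

theorem law_law [Fintype A] (q : Ω → ℝ) (f : Ω → A) (g : A → B) :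
    law (law q f) g = law q (g ∘ f) := by
  classical
  ext b
  simpa [law] using sum_law_mul q f (fun a => if g a = b then 1 else 0)

theorem law_nonneg {q : Ω → ℝ} (hq : ∀ ω, 0 ≤ q ω) (f : Ω → A) (a : A) : 0 ≤ law q f a :=
  Finset.sum_nonneg fun ω _ => by split_ifs <;> simp [hq]

theorem le_law {q : Ω → ℝ} (hq : ∀ ω, 0 ≤ q ω) (f : Ω → A) (ω : Ω) : q ω ≤ law q f (f ω) := by
  classical
  have := Finset.single_le_sum (f := fun ω' => if f ω' = f ω then q ω' else 0)
    (fun ω' _ => by split_ifs <;> simp [hq]) (Finset.mem_univ ω)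
  simpa [law] using this

theorem law_pos {q : Ω → ℝ} (hq : ∀ ω, 0 ≤ q ω) (f : Ω → A) {ω : Ω} (h : q ω ≠ 0) :
    0 < law q f (f ω) :=
  ((hq ω).lt_of_ne' h).trans_le (le_law hq f ω)

theorem law_le_law {q : Ω → ℝ} (hq : ∀ ω, 0 ≤ q ω) {f : Ω → A} {g : Ω → B}
    (hfg : ∀ ω ω', f ω = f ω' → g ω = g ω') (ω : Ω) : law q f (f ω) ≤ law q g (g ω) := by
  classical
  refine Finset.sum_le_sum fun ω' _ => ?_
  by_cases h : f ω' = f ω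
  · simp [h, hfg _ _ h]
  · simp only [h, if_false]; split_ifs <;> simp [hq]

theorem law_congr {q : Ω → ℝ} {f : Ω → A} {g : Ω → B}
    (hfg : ∀ ω ω', f ω = f ω' ↔ g ω = g ω') (ω : Ω) : law q f (f ω) = law q g (g ω) := by
  classical
  exact Finset.sum_congr rfl fun _ _ => if_congr (hfg _ _) rfl rfl

theorem entropyOf_congr {q : Ω → ℝ} {f : Ω → A} {g : Ω → B}
    (hfg : ∀ ω ω', f ω = f ω' ↔ g ω = g ω') : entropyOf q f = entropyOf q g := by
  simp only [entropyOf, law_congr hfg]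

theorem entropyOf_mono {q : Ω → ℝ} (hq : ∀ ω, 0 ≤ q ω) {f : Ω → A} {g : Ω → B}
    (hfg : ∀ ω ω', f ω = f ω' → g ω = g ω') : entropyOf q g ≤ entropyOf q f := by
  refine neg_le_neg (Finset.sum_le_sum fun ω _ => ?_)
  rcases eq_or_ne (q ω) 0 with h | h
  · simp [h]
  · exact mul_le_mul_of_nonneg_left
      (Real.logb_le_logb_of_le one_lt_two (law_pos hq f h) (law_le_law hq hfg ω)) (hq ω)

theorem entropyOf_eq_zero {q : Ω → ℝ} (hq1 : ∑ ω, q ω = 1) {f : Ω → A}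
    (hf : ∀ ω ω', f ω = f ω') : entropyOf q f = 0 := by
  have h : ∀ ω, law q f (f ω) = 1 := fun ω => by simp [law, hf _ ω, hq1]
  simp [entropyOf, h]

/-- All of `P` lies in one fibre of `f`, so the sum is the conditional probability of `P` in that
fibre, or `0` if the fibre is null. -/
theorem sum_div_law_le_one {q : Ω → ℝ} (hq : ∀ ω, 0 ≤ q ω) (f : Ω → A) (P : Ω → Prop)
    [DecidablePred P] (hP : ∀ ω ω', P ω → P ω' → f ω = f ω') :
    ∑ ω, (if P ω then q ω / law q f (f ω) else 0) ≤ 1 := by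
  classical
  by_cases hex : ∃ ω, P ω
  · obtain ⟨ω₀, h₀⟩ := hex
    calc ∑ ω, (if P ω then q ω / law q f (f ω) else 0)
        ≤ ∑ ω, (if f ω = f ω₀ then q ω else 0) / law q f (f ω₀) := by
          refine Finset.sum_le_sum fun ω _ => ?_
          by_cases h : P ω
          · simp [h, hP _ _ h h₀]
          · simp only [h, if_false]
            exact div_nonneg (by split_ifs <;> simp [hq]) (law_nonneg hq _ _)
      _ = law q f (f ω₀) / law q f (f ω₀) := by rw [← Finset.sum_div, law]
      _ ≤ 1 := div_self_le_one _
  · push Not at hex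
    simp [hex]

/-- The sum which bounds conditional mutual information from below through `log t ≤ t - 1`. -/
theorem sum_mul_law_ratio_le {q : Ω → ℝ} (hq : ∀ ω, 0 ≤ q ω)
    {x : Ω → A} {u : Ω → B} {v : Ω → C} {w : Ω → E}
    (hux : ∀ ω ω', u ω = u ω' → x ω = x ω') (hvx : ∀ ω ω', v ω = v ω' → x ω = x ω')
    (hw : ∀ ω ω', u ω = u ω' → v ω = v ω' → w ω = w ω') :
    ∑ ω, q ω * (law q u (u ω) * law q v (v ω) / (law q w (w ω) * law q x (x ω)))
      ≤ ∑ ω, q ω := by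
  classical
  -- The two laws in the numerator become sums over sample points `a`, `b`. Both agree with `ω`
  -- under `x`, so the denominator can be written with `x a`, which frees the sum over `ω`.
  have expand : ∀ ω, q ω * (law q u (u ω) * law q v (v ω) / (law q w (w ω) * law q x (x ω))) =
      ∑ a, ∑ b, (if u a = u ω ∧ v b = v ω then q ω / law q w (w ω) else 0) *
        (if x b = x a then q a * q b / law q x (x a) else 0) := by
    intro ω
    have h1 : law q u (u ω) * law q v (v ω) =
        ∑ a, ∑ b, (if u a = u ω then q a else 0) * (if v b = v ω then q b else 0) := by
      rw [law, law, Finset.sum_mul_sum]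
    rw [h1, Finset.sum_div, Finset.mul_sum]
    refine Finset.sum_congr rfl fun a _ => ?_
    rw [Finset.sum_div, Finset.mul_sum]
    refine Finset.sum_congr rfl fun b _ => ?_
    by_cases ha : u a = u ω
    · by_cases hb : v b = v ω
      · have e1 := hux _ _ ha
        have e2 := hvx _ _ hb
        simp only [ha, hb, e1, e2, if_true, and_self]
        ring
      · simp [hb]
    · simp [ha]
  calc ∑ ω, q ω * (law q u (u ω) * law q v (v ω) / (law q w (w ω) * law q x (x ω)))
      = ∑ a, ∑ b, (∑ ω, if u a = u ω ∧ v b = v ω then q ω / law q w (w ω) else 0) *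
          (if x b = x a then q a * q b / law q x (x a) else 0) := by
        simp only [expand]
        rw [Finset.sum_comm]
        refine Finset.sum_congr rfl fun a _ => ?_
        rw [Finset.sum_comm]
        simp only [Finset.sum_mul]
    _ ≤ ∑ a, ∑ b, (if x b = x a then q a * q b / law q x (x a) else 0) := by
        refine Finset.sum_le_sum fun a _ => Finset.sum_le_sum fun b _ => ?_
        refine mul_le_of_le_one_left ?_ (sum_div_law_le_one hq w _ ?_)
        · split_ifs
          · exact div_nonneg (mul_nonneg (hq _) (hq _)) (law_nonneg hq _ _)
          · exact le_rfl
        · rintro ω ω' ⟨h1, h2⟩ ⟨h3, h4⟩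
          exact hw _ _ (h1.symm.trans h3) (h2.symm.trans h4)
    _ = ∑ a, q a * (law q x (x a) / law q x (x a)) := by
        refine Finset.sum_congr rfl fun a _ => ?_
        have : law q x (x a) = ∑ b, if x b = x a then q b else 0 := by simp [law]
        conv_rhs => rw [← mul_div_assoc, mul_comm, mul_div_assoc]
        rw [this, Finset.sum_mul, ← this]
        refine Finset.sum_congr rfl fun b _ => ?_
        split_ifs
        · ring
        · simp
    _ ≤ ∑ a, q a :=
        Finset.sum_le_sum fun a _ => mul_le_of_le_one_right (hq a) (div_self_le_one _)

theorem entropyOf_submodular {q : Ω → ℝ} (hq : ∀ ω, 0 ≤ q ω)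
    {x : Ω → A} {u : Ω → B} {v : Ω → C} {w : Ω → E}
    (hux : ∀ ω ω', u ω = u ω' → x ω = x ω') (hvx : ∀ ω ω', v ω = v ω' → x ω = x ω')
    (hw : ∀ ω ω', u ω = u ω' → v ω = v ω' → w ω = w ω') :
    entropyOf q w + entropyOf q x ≤ entropyOf q u + entropyOf q v := by
  have hlog : 0 < Real.log 2 := Real.log_pos one_lt_two
  have key : ∀ ω, q ω * (Real.logb 2 (law q u (u ω)) + Real.logb 2 (law q v (v ω))
      - Real.logb 2 (law q w (w ω)) - Real.logb 2 (law q x (x ω))) ≤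
      (q ω * (law q u (u ω) * law q v (v ω) / (law q w (w ω) * law q x (x ω))) - q ω)
        / Real.log 2 := by
    intro ω
    rcases eq_or_ne (q ω) 0 with h | h
    · simp [h]
    have hu := law_pos hq u h
    have hv := law_pos hq v h
    have hw := law_pos hq w h
    have hx := law_pos hq x h
    have := Real.log_le_sub_one_of_pos (div_pos (mul_pos hu hv) (mul_pos hw hx))
    rw [Real.log_div (mul_pos hu hv).ne' (mul_pos hw hx).ne', Real.log_mul hu.ne' hv.ne',
      Real.log_mul hw.ne' hx.ne'] at this
    have := mul_le_mul_of_nonneg_left this (hq ω)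
    rw [le_div_iff₀ hlog]
    simp only [Real.logb]
    calc _ = q ω * (Real.log (law q u (u ω)) + Real.log (law q v (v ω))
          - (Real.log (law q w (w ω)) + Real.log (law q x (x ω)))) := by
          field_simp
          ring
      _ ≤ _ := by linarith
  have hsum := Finset.sum_le_sum fun ω (_ : ω ∈ Finset.univ) => key ω
  rw [← Finset.sum_div, Finset.sum_sub_distrib] at hsum
  have hle := sum_mul_law_ratio_le hq hux hvx hw
  have hneg := hsum.trans (div_nonpos_of_nonpos_of_nonneg (sub_nonpos.2 hle) hlog.le)
  simp only [mul_sub, mul_add, Finset.sum_sub_distrib, Finset.sum_add_distrib] at hneg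
  simp only [entropyOf]
  linarith

/-- The entropy of a pair of independent variables is the sum of the entropies. -/
theorem entropyOf_prod {Ω' : Type} [Fintype Ω'] {q : Ω → ℝ} {q' : Ω' → ℝ}
    (hq : ∀ ω, 0 ≤ q ω) (hq' : ∀ ω, 0 ≤ q' ω) (h1 : ∑ ω, q ω = 1) (h1' : ∑ ω, q' ω = 1)
    (f : Ω → A) (g : Ω' → B) :
    entropyOf (fun z : Ω × Ω' => q z.1 * q' z.2) (Prod.map f g) =
      entropyOf q f + entropyOf q' g := by
  classical
  have hlaw : ∀ a b, law (fun z : Ω × Ω' => q z.1 * q' z.2) (Prod.map f g) (a, b) =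
      law q f a * law q' g b := by
    intro a b
    rw [law, law, law, Finset.sum_mul_sum, Fintype.sum_prod_type]
    refine Finset.sum_congr rfl fun ω _ => Finset.sum_congr rfl fun ω' _ => ?_
    by_cases ha : f ω = a <;> by_cases hb : g ω' = b <;> simp [ha, hb]
  have hterm : ∀ ω ω', q ω * q' ω' * Real.logb 2 (law q f (f ω) * law q' g (g ω')) =
      q' ω' * (q ω * Real.logb 2 (law q f (f ω))) +
        q ω * (q' ω' * Real.logb 2 (law q' g (g ω'))) := by
    intro ω ω'
    rcases eq_or_ne (q ω) 0 with h | h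
    · simp [h]
    rcases eq_or_ne (q' ω') 0 with h' | h'
    · simp [h']
    rw [Real.logb_mul (law_pos hq f h).ne' (law_pos hq' g h').ne']
    ring
  simp only [entropyOf, Fintype.sum_prod_type, Prod.map_apply, hlaw, hterm,
    Finset.sum_add_distrib, ← Finset.sum_mul, ← Finset.mul_sum, h1, h1']
  ring

/-- The mass function on `Option Ω` of `q` with probability `δ`, and `none` otherwise. -/
def mixNone (δ : ℝ) (q : Ω → ℝ) : Option Ω → ℝ
  | none => 1 - δ
  | some ω => δ * q ω

/-- Chain rule: `g` reveals whether `none` occurred, costing the binary entropy, and otherwise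
carries the information of `f` with probability `δ`. -/
theorem entropyOf_mixNone {q : Ω → ℝ} (hq : ∀ ω, 0 ≤ q ω) (h1 : ∑ ω, q ω = 1) (δ : ℝ)
    {f : Ω → A} {g : Option Ω → B} (hsome : ∀ ω ω', g (some ω) = g (some ω') ↔ f ω = f ω')
    (hnone : ∀ ω, g (some ω) ≠ g none) :
    entropyOf (mixNone δ q) g = δ * entropyOf q f + Real.binEntropy δ / Real.log 2 := by
  classical
  have l0 : law (mixNone δ q) g (g none) = 1 - δ := by
    simp [law, Fintype.sum_option, hnone, mixNone]
  have l1 : ∀ ω, law (mixNone δ q) g (g (some ω)) = δ * law q f (f ω) := by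
    intro ω
    simp [law, Fintype.sum_option, (hnone ω).symm, mixNone, hsome, Finset.mul_sum]
  have hterm : ∀ ω, δ * q ω * Real.logb 2 (δ * law q f (f ω)) =
      q ω * (δ * Real.logb 2 δ) + δ * (q ω * Real.logb 2 (law q f (f ω))) := by
    intro ω
    rcases eq_or_ne δ 0 with h | h
    · simp [h]
    rcases eq_or_ne (q ω) 0 with h' | h'
    · simp [h']
    rw [Real.logb_mul h (law_pos hq f h').ne']
    ring
  simp only [entropyOf, Fintype.sum_option, l0, l1, mixNone]
  simp only [hterm, Finset.sum_add_distrib, ← Finset.sum_mul, ← Finset.mul_sum, h1]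
  simp only [Real.binEntropy, Real.log_inv, ← Real.log_div_log]
  ring

end Entropy

/-! ### The cone of almost entropic functions and compactness -/

section EntropicFunctions

variable {n : ℕ}

/-- `h` is given by the entropies of variables `f i` on some finite probability space. -/
def IsRealized (h : Finset (Fin n) → ℝ) : Prop :=
  ∃ (Ω : Type) (_ : Fintype Ω) (D : Fin n → Type) (_ : ∀ i, Fintype (D i)) (q : Ω → ℝ)
    (f : Ω → ∀ i, D i), (∀ ω, 0 ≤ q ω) ∧ ∑ ω, q ω = 1 ∧
      ∀ α : Finset (Fin n), h α = entropyOf q (fun ω (i : α) => f ω i)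

theorem mem_entropicFunctions_iff {h : Finset (Fin n) → ℝ} :
    h ∈ entropicFunctions n ↔ IsRealized h := by
  constructor
  · rintro ⟨D, _, p, hp, h1, hα⟩
    classical
    refine ⟨∀ i, D i, inferInstance, D, inferInstance, p, id, hp, h1, fun α => ?_⟩
    rw [hα, ← shannonEntropy_law]
    congr 1
    ext y
    simp only [marginal, law, id]
    congr!
  · rintro ⟨Ω, _, D, _, q, f, hq, h1, hα⟩
    refine ⟨D, inferInstance, law q f, law_nonneg hq f, ?_, fun α => ?_⟩
    · rw [← h1, ← sum_law q f]
    · rw [hα, ← shannonEntropy_law]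
      congr 1
      have := law_law q f (fun (x : ∀ i, D i) (i : α) => x i)
      rw [Function.comp_def] at this
      rw [← this]
      ext y
      simp only [marginal, law]
      congr!

theorem zero_mem_entropicFunctions : (0 : Finset (Fin n) → ℝ) ∈ entropicFunctions n := by
  rw [mem_entropicFunctions_iff]
  refine ⟨Unit, inferInstance, fun _ => Unit, inferInstance, 1, fun _ _ => (), by simp, by simp,
    fun α => ?_⟩
  rw [entropyOf_eq_zero (by simp) (by simp), Pi.zero_apply]

theorem add_mem_entropicFunctions {h h' : Finset (Fin n) → ℝ} (hh : h ∈ entropicFunctions n)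
    (hh' : h' ∈ entropicFunctions n) : h + h' ∈ entropicFunctions n := by
  rw [mem_entropicFunctions_iff] at *
  obtain ⟨Ω, _, D, _, q, f, hq, h1, hα⟩ := hh
  obtain ⟨Ω', _, D', _, q', f', hq', h1', hα'⟩ := hh'
  refine ⟨Ω × Ω', inferInstance, fun i => D i × D' i, inferInstance, fun z => q z.1 * q' z.2,
    fun z i => (f z.1 i, f' z.2 i), fun z => mul_nonneg (hq _) (hq' _), ?_, fun α => ?_⟩
  · simp [Fintype.sum_prod_type, ← Finset.mul_sum, h1, h1']
  · rw [Pi.add_apply, hα, hα', ← entropyOf_prod hq hq' h1 h1']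
    refine entropyOf_congr fun z z' => ?_
    simp [funext_iff, forall_and, Prod.map]

theorem nsmul_mem_entropicFunctions {h : Finset (Fin n) → ℝ} (hh : h ∈ entropicFunctions n)
    (k : ℕ) : k • h ∈ entropicFunctions n := by
  induction k with
  | zero => simpa using zero_mem_entropicFunctions
  | succ k ih => rw [succ_nsmul]; exact add_mem_entropicFunctions ih hh

/-- All variables jointly take an extra symbol with probability `1 - δ`. Every nonempty `α` sees
this event; the empty one does not. -/
theorem mix_mem_entropicFunctions {h : Finset (Fin n) → ℝ} (hh : h ∈ entropicFunctions n)
    {δ : ℝ} (h0 : 0 ≤ δ) (hδ : δ ≤ 1) :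
    (fun α => δ * h α + if α = ∅ then 0 else Real.binEntropy δ / Real.log 2) ∈
      entropicFunctions n := by
  rw [mem_entropicFunctions_iff] at *
  obtain ⟨Ω, _, D, _, q, f, hq, h1, hα⟩ := hh
  have hsum : ∑ z, mixNone δ q z = 1 := by
    simp [Fintype.sum_option, mixNone, ← Finset.mul_sum, h1]
  refine ⟨Option Ω, inferInstance, fun i => Option (D i), inferInstance, mixNone δ q,
    fun z i => z.map (f · i), ?_, hsum, fun α => ?_⟩
  · rintro (_ | ω)
    · exact sub_nonneg.2 hδ
    · exact mul_nonneg h0 (hq ω)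
  · beta_reduce
    rcases α.eq_empty_or_nonempty with rfl | ⟨i, hi⟩
    · rw [hα, entropyOf_eq_zero h1 fun _ _ => Subsingleton.elim _ _,
        entropyOf_eq_zero hsum fun _ _ => Subsingleton.elim _ _]
      simp
    · rw [if_neg (Finset.ne_empty_of_mem hi), hα]
      refine (entropyOf_mixNone hq h1 δ (fun ω ω' => ?_) fun ω hω => ?_).symm
      · simp [funext_iff]
      · simpa using congrFun hω ⟨i, hi⟩

-- Mixing `k • g` with `δ = c / k` gives `c • g` up to an error `binEntropy (c / k) / log 2`, which
-- tends to `0`.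
open Filter Topology in
theorem smul_mem_almostEntropicFunctions {h : Finset (Fin n) → ℝ}
    (hh : h ∈ almostEntropicFunctions n) {c : ℝ} (hc : 0 ≤ c) :
    c • h ∈ almostEntropicFunctions n := by
  suffices hmaps : Set.MapsTo (c • ·) (entropicFunctions n) (almostEntropicFunctions n) by
    simpa only [almostEntropicFunctions, closure_closure] using
      map_mem_closure (continuous_const_smul c) hh hmaps
  intro g hg
  have hlim : Tendsto (fun k : ℕ => c / k) atTop (𝓝 0) := tendsto_const_div_atTop_nhds_zero_nat c
  refine mem_closure_of_tendsto (b := atTop) (f := fun (k : ℕ) α =>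
    c / k * (k • g) α + if α = ∅ then 0 else Real.binEntropy (c / k) / Real.log 2) ?_ ?_
  · refine tendsto_pi_nhds.2 fun α => ?_
    have h1 : Tendsto (fun k : ℕ => c / k * (k • g) α) atTop (𝓝 (c * g α)) := by
      refine tendsto_const_nhds.congr' ?_
      filter_upwards [eventually_ne_atTop 0] with k hk
      have : (k : ℝ) ≠ 0 := Nat.cast_ne_zero.2 hk
      simp only [Pi.smul_apply, nsmul_eq_mul]
      field_simp
    have h2 : Tendsto (fun k : ℕ => if α = ∅ then (0 : ℝ) else
        Real.binEntropy (c / k) / Real.log 2) atTop (𝓝 0) := by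
      split_ifs
      · exact tendsto_const_nhds
      · simpa using ((Real.binEntropy_continuous.tendsto 0).comp hlim).div_const (Real.log 2)
    simpa using h1.add h2
  · filter_upwards [hlim.eventually_le_const one_pos] with k hk
    exact mix_mem_entropicFunctions (nsmul_mem_entropicFunctions hg k) (by positivity) hk

theorem mono_of_mem_almostEntropicFunctions {h : Finset (Fin n) → ℝ}
    (hh : h ∈ almostEntropicFunctions n) {α β : Finset (Fin n)} (hαβ : α ⊆ β) : h α ≤ h β := by
  refine closure_minimal (t := {h : Finset (Fin n) → ℝ | h α ≤ h β}) ?_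
    (isClosed_le (continuous_apply α) (continuous_apply β)) hh
  intro h hh
  obtain ⟨Ω, _, D, _, q, f, hq, -, hα⟩ := mem_entropicFunctions_iff.1 hh
  rw [Set.mem_ofPred_eq, hα, hα]
  refine entropyOf_mono hq fun ω ω' e => ?_
  ext i
  exact congrFun e ⟨i, hαβ i.2⟩

theorem empty_of_mem_almostEntropicFunctions {h : Finset (Fin n) → ℝ}
    (hh : h ∈ almostEntropicFunctions n) : h ∅ = 0 := by
  refine closure_minimal (t := {h : Finset (Fin n) → ℝ | h ∅ = 0}) ?_
    (isClosed_eq (continuous_apply _) continuous_const) hh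
  intro h hh
  obtain ⟨Ω, _, D, _, q, f, -, h1, hα⟩ := mem_entropicFunctions_iff.1 hh
  rw [Set.mem_ofPred_eq, hα]
  exact entropyOf_eq_zero h1 fun _ _ => Subsingleton.elim _ _

theorem nonneg_of_mem_almostEntropicFunctions {h : Finset (Fin n) → ℝ}
    (hh : h ∈ almostEntropicFunctions n) (α : Finset (Fin n)) : 0 ≤ h α :=
  empty_of_mem_almostEntropicFunctions hh ▸
    mono_of_mem_almostEntropicFunctions hh (Finset.empty_subset α)

theorem CI.continuous_value (σ : CI n) : Continuous fun h => CI.value h σ := by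
  unfold CI.value
  fun_prop

theorem continuous_ciSum (S : Finset (CI n)) : Continuous fun h => ciSum h S :=
  continuous_finsetSum S fun σ _ => CI.continuous_value σ

theorem CI.value_nonneg {h : Finset (Fin n) → ℝ} (hh : h ∈ almostEntropicFunctions n)
    (σ : CI n) : 0 ≤ CI.value h σ := by
  refine closure_minimal (t := {h | 0 ≤ CI.value h σ}) ?_
    (isClosed_le continuous_const (CI.continuous_value σ)) hh
  intro h hh
  obtain ⟨Ω, _, D, _, q, f, hq, -, hα⟩ := mem_entropicFunctions_iff.1 hh
  have := entropyOf_submodular hq (x := fun ω (i : σ.X) => f ω i)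
    (u := fun ω (i : ↥(σ.X ∪ σ.Y)) => f ω i) (v := fun ω (i : ↥(σ.X ∪ σ.Z)) => f ω i)
    (w := fun ω (i : ↥(σ.X ∪ σ.Y ∪ σ.Z)) => f ω i) ?_ ?_ ?_
  · simp only [← hα] at this
    rw [Set.mem_ofPred_eq, CI.value]
    linarith
  all_goals
    simp only [funext_iff, Subtype.forall, Finset.mem_union]
    grind

theorem ciSum_nonneg {h : Finset (Fin n) → ℝ} (hh : h ∈ almostEntropicFunctions n)
    (S : Finset (CI n)) : 0 ≤ ciSum h S :=
  Finset.sum_nonneg fun σ _ => CI.value_nonneg hh σ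

theorem CI.value_smul (c : ℝ) (h : Finset (Fin n) → ℝ) (σ : CI n) :
    CI.value (c • h) σ = c * CI.value h σ := by
  simp only [CI.value, Pi.smul_apply, smul_eq_mul]
  ring

theorem ciSum_smul (c : ℝ) (h : Finset (Fin n) → ℝ) (S : Finset (CI n)) :
    ciSum (c • h) S = c * ciSum h S := by
  simp only [ciSum, CI.value_smul, Finset.mul_sum]

theorem CI.value_le {h : Finset (Fin n) → ℝ} (hh : h ∈ almostEntropicFunctions n)
    (σ : CI n) : CI.value h σ ≤ 2 * h Finset.univ := by
  have h1 := mono_of_mem_almostEntropicFunctions hh (Finset.subset_univ (σ.X ∪ σ.Y))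
  have h2 := mono_of_mem_almostEntropicFunctions hh (Finset.subset_univ (σ.X ∪ σ.Z))
  have h3 := nonneg_of_mem_almostEntropicFunctions hh (σ.X ∪ σ.Y ∪ σ.Z)
  have h4 := nonneg_of_mem_almostEntropicFunctions hh σ.X
  rw [CI.value]
  linarith

/-- The almost entropic functions with `h([n]) = 1` form a compact base of the cone. -/
theorem isCompact_normalized_almostEntropicFunctions :
    IsCompact {h ∈ almostEntropicFunctions n | h Finset.univ = 1} := by
  refine (isCompact_Icc (a := (0 : Finset (Fin n) → ℝ)) (b := 1)).of_isClosed_subset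
    (isClosed_closure.inter (isClosed_eq (continuous_apply _) continuous_const)) ?_
  rintro h ⟨hh, h1⟩
  exact ⟨fun α => nonneg_of_mem_almostEntropicFunctions hh α, fun α =>
    (mono_of_mem_almostEntropicFunctions hh (Finset.subset_univ α)).trans_eq h1⟩

theorem exists_bound_of_normalized {S : Finset (CI n)} {τ : CI n}
    (hS : ExactImplication (almostEntropicFunctions n) S τ) {ε : ℝ} (hε : 0 < ε) :
    ∃ l : ℝ, 0 < l ∧ ∀ h ∈ almostEntropicFunctions n, h Finset.univ = 1 →
      CI.value h τ ≤ l * ciSum h S + ε := by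
  have hcomp : IsCompact ({h ∈ almostEntropicFunctions n | h Finset.univ = 1} ∩
      {h | ε ≤ CI.value h τ}) :=
    isCompact_normalized_almostEntropicFunctions.inter_right
      (isClosed_le continuous_const (CI.continuous_value τ))
  obtain ⟨m, hm, hmin⟩ : ∃ m : ℝ, 0 < m ∧ ∀ h ∈ almostEntropicFunctions n, h Finset.univ = 1 →
      ε ≤ CI.value h τ → m ≤ ciSum h S := by
    rcases Set.eq_empty_or_nonempty ({h ∈ almostEntropicFunctions n | h Finset.univ = 1} ∩
      {h | ε ≤ CI.value h τ}) with he | hne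
    · exact ⟨1, one_pos, fun h hh h1 h2 =>
        (Set.eq_empty_iff_forall_notMem.1 he h ⟨⟨hh, h1⟩, h2⟩).elim⟩
    · obtain ⟨g, ⟨⟨hg, -⟩, hgε⟩, hgmin⟩ := hcomp.exists_isMinOn hne (continuous_ciSum S).continuousOn
      refine ⟨ciSum g S, (ciSum_nonneg hg S).lt_of_ne' fun h0 => ?_,
        fun h hh h1 h2 => hgmin ⟨⟨hh, h1⟩, h2⟩⟩
      exact (hε.trans_le hgε).ne' (hS g hg h0)
  -- If `h(τ) ≥ ε`, then `h(Σ) ≥ m` and `h(τ) ≤ 2`; otherwise the `ε` term suffices.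
  refine ⟨2 / m, by positivity, fun h hh h1 => ?_⟩
  rcases le_total (CI.value h τ) ε with hle | hle
  · have := mul_nonneg (div_pos two_pos hm).le (ciSum_nonneg hh S)
    linarith
  · have h2 := CI.value_le hh τ
    have h3 := mul_le_mul_of_nonneg_left (hmin h hh h1 hle) (div_pos two_pos hm).le
    rw [div_mul_cancel₀ _ hm.ne'] at h3
    rw [h1] at h2
    linarith

end EntropicFunctions

theorem theorem5p2 (n : ℕ) (S : Finset (CI n)) (τ : CI n)
    (hS : ExactImplication (almostEntropicFunctions n) S τ) :
    ∀ ε : ℝ, 0 < ε → ∃ l : ℝ, 0 < l ∧ ∀ h ∈ almostEntropicFunctions n,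
      CI.value h τ ≤ l * ciSum h S + ε * h Finset.univ := by
  intro ε hε
  obtain ⟨l, hl, hbound⟩ := exists_bound_of_normalized hS hε
  refine ⟨l, hl, fun h hh => ?_⟩
  -- When `h([n]) = 0` normalization is impossible, but `h(τ) ≤ 2 h([n])` settles the claim.
  rcases (nonneg_of_mem_almostEntropicFunctions hh Finset.univ).eq_or_lt with h0 | hpos
  · have h1 := CI.value_le hh τ
    have h2 := mul_nonneg hl.le (ciSum_nonneg hh S)
    rw [← h0] at h1 ⊢
    linarith
  · have := hbound _ (smul_mem_almostEntropicFunctions hh (inv_nonneg.2 hpos.le))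
      (by simp [hpos.ne'])
    rw [CI.value_smul, ciSum_smul] at this
    have := mul_le_mul_of_nonneg_left this hpos.le
    calc CI.value h τ = h Finset.univ * ((h Finset.univ)⁻¹ * CI.value h τ) := by field_simp
      _ ≤ _ := this
      _ = _ := by field_simp
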